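/- Let $K$ and $L$ be number fields with rings of integers $O_K$, $O_L$, let $E$ be a compositum of $K$ and $L$ (a number field with embeddings $\iota_K: K\to E$ and $\iota_L: L\to E$ whose images together generate $E$), and let $\phi: K\to L$ be a $\mathbb{Q}$-linear isomorphism with $\mathrm{Tr}_{L/\mathbb{Q}}(\phi(x)\phi(y))=\mathrm{Tr}_{K/\mathbb{Q}}(xy)$ for all $x,y\in K$ and $\phi(O_K)=O_L$. Let $c\in E$ be the Casimir element $c=\langle \iota_K,\iota_L\phi\rangle_{\mathrm{tr}_{K/\mathbb{Q}}}$, that is, the image of the identity under the linear map $\mathrm{End}_{\mathbb{Q}}(K)\cong K^*\otimes_{\mathbb{Q}}K\to E$, $f\otimes v\mapsto \iota_K(\Gamma^{-1}(f))\,\iota_L(\phi(v))$, where $K^*=\mathrm{Hom}_{\mathbb{Q}}(K,\mathbb{Q})$ and $\Gamma: K\to K^*$ is the isomorphism $x\mapsto \mathrm{Tr}_{K/\mathbb{Q}}(x\,\cdot\,)$. Equivalently, $c=\sum_i \iota_K(v_i^*)\,\iota_L(\phi(v_i))$ for any $\mathbb{Q}$-basis $(v_i)$ of $K$ with dual basis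 $(v_i^*)$ with respect to the trace form. Write the discriminant $d_K$ of $K$ as $d_K=d_s d_f$, where $d_f$ is the product of the primes dividing $d_K$ exactly once. For a nonzero integer $m$ let $\mathrm{rad}(m)$ be the product of the distinct primes dividing $m$. Then: 1. $d_s c$ is an algebraic integer. 2. If $K$ has no wild ramification (that is, for every rational prime $p$ and every prime $\mathfrak{p}$ of $O_K$ over $p$, the ramification index $e(\mathfrak{p}|p)$ is not divisible by $p$), then $\mathrm{rad}(d_s)\,c$ is an algebraic integer. 3. In particular, if $d_K$ is squarefree, then $c$ is an algebraic integer. -/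

import Mathlib

open scoped TensorProduct

noncomputable section

/-- For an isomorphism `Γ : V ≃ V*` and `F`-linear maps `ψ, φ : V → R` into an `F`-algebra, the
linear map `End(V) ≅ V* ⊗ V → R` induced by `f ⊗ v ↦ ψ (Γ⁻¹ f) * φ v`. -/
def casimirRho {F V R : Type*} [Field F] [AddCommGroup V] [Module F V] [FiniteDimensional F V]
    [Ring R] [Algebra F R] (Γ : V ≃ₗ[F] Module.Dual F V) (ψ φ : V →ₗ[F] R) :
    Module.End F V →ₗ[F] R :=
  TensorProduct.lift ((LinearMap.mul F R).compl₁₂ (ψ ∘ₗ Γ.symm.toLinearMap) φ) ∘ₗ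
    (dualTensorHomEquiv F V V).symm.toLinearMap

/-- The Casimir pairing `⟨ψ, φ⟩_Γ`: the image of the identity endomorphism under `casimirRho`. -/
def casimirPairing {F V R : Type*} [Field F] [AddCommGroup V] [Module F V] [FiniteDimensional F V]
    [Ring R] [Algebra F R] (Γ : V ≃ₗ[F] Module.Dual F V) (ψ φ : V →ₗ[F] R) : R :=
  casimirRho Γ ψ φ 1

/-- The Casimir pairing on `Hom_F(K, R)` associated to the trace pairing of a finite separable
field extension `K / F`. -/
def traceCasimirPairing (F K : Type*) {R : Type*} [Field F] [Field K] [Algebra F K]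
    [FiniteDimensional F K] [Algebra.IsSeparable F K] [Ring R] [Algebra F R]
    (ψ φ : K →ₗ[F] R) : R :=
  casimirPairing
    (LinearMap.BilinForm.toDual (Algebra.traceForm F K) (traceForm_nondegenerate F K)) ψ φ

/-- An isometry `(K, tr_{K/ℚ}) ≃ (L, tr_{L/ℚ})` that carries the maximal order of `K` onto the
maximal order of `L`. -/
structure IsIntegralTraceIsometry {K L : Type*} [Field K] [NumberField K] [Field L] [NumberField L]
    (φ : K ≃ₗ[ℚ] L) : Prop where
  trace_eq : ∀ x y : K, Algebra.trace ℚ L (φ x * φ y) = Algebra.trace ℚ K (x * y)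
  image_integers : φ '' {x : K | IsIntegral ℤ x} = {y : L | IsIntegral ℤ y}

/-- The product of the primes that divide the integer `d` exactly once. -/
def exactPrimePart (d : ℤ) : ℕ :=
  ∏ p ∈ d.natAbs.primeFactors with ¬ p ^ 2 ∣ d.natAbs, p

/-- `K` has no wild ramification: no ramification index of a nonzero prime of `𝓞 K` is divisible by
the rational prime `p` below it. -/
def NoWildRamification (K : Type*) [Field K] [NumberField K] : Prop :=
  ∀ (p : ℕ) (P : Ideal (NumberField.RingOfIntegers K)), p.Prime → P.IsPrime →
    P.LiesOver (Ideal.span {(p : ℤ)}) →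
    ¬ p ∣ Ideal.ramificationIdx' (Ideal.span {(p : ℤ)}) P

end

/-!
Integrality of the Casimir element `c` is checked one prime number `p` at a time.

In `c = ∑ ιK (vᵢ*) * ιL (φ vᵢ)` for an integral basis `(vᵢ)`, the `vᵢ*` lie in the inverse
different `D⁻¹`, so `n * c` is integral for every integer `n` in the different `D`. The
discriminant lies in `D`; and if every prime above `p` is tamely ramified, the exponent of `D`
there is smaller than the ramification index, so that `p * c` is integral at `p`.

If `p² ∤ d_K`, then at `p` the inverse different is the sum of the ring of integers and of a line
spanned by some `w`; if `p ∣ d_K`, an element `z` has the component `s * tr (z * w) * w` on that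
line, where `s` is the inverse of `tr (w * w)`, and otherwise one takes `w = 0`. Accordingly `c`
is the sum of an element integral at `p` and of `s * ιK w * ιL (φ w)`. The square of the latter is
`ιK (s * w²) * ιL (s * (φ w)²)`, and `φ` carries the splitting for `K` to one for `L`, so it
remains to see that `s * w²` is integral at `p`. The map `y ↦ w * y - s * tr (w² * y) * w`
preserves integrality at `p`; hence its trace `tr w - s * tr (w³)` is integral at `p`, hence so is
`s * tr (w³)`, and evaluating the map at `s * w` gives the claim.
-/

open scoped nonZeroDivisors NumberField

section LocalIntegralClosure

variable {A R R' : Type*} [CommRing A] [CommRing R] [Algebra A R] [CommRing R'] [Algebra A R']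

/-- The integral closure of `M⁻¹A` in an `M⁻¹A`-algebra `R`, described without forming the
localization `M⁻¹A`. -/
def localIntegralClosure (M : Submonoid A) (R : Type*) [CommRing R] [Algebra A R] :
    Subalgebra A R where
  carrier := {x | ∃ s ∈ M, IsIntegral A (s • x)}
  mul_mem' := by
    rintro x y ⟨s, hs, hx⟩ ⟨t, ht, hy⟩
    exact ⟨s * t, mul_mem hs ht, by simpa only [smul_mul_smul_comm] using hx.mul hy⟩
  add_mem' := by
    rintro x y ⟨s, hs, hx⟩ ⟨t, ht, hy⟩
    refine ⟨s * t, mul_mem hs ht, ?_⟩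
    rw [smul_add, mul_comm s t, mul_smul, mul_comm t s, mul_smul]
    exact (hx.smul t).add (hy.smul s)
  algebraMap_mem' a := ⟨1, one_mem M, by simpa only [one_smul] using isIntegral_algebraMap⟩

namespace localIntegralClosure

variable {M : Submonoid A} {x : R}

theorem mem_of_isIntegral (hx : IsIntegral A x) : x ∈ localIntegralClosure M R :=
  ⟨1, one_mem M, by rwa [one_smul]⟩

theorem of_smul_mem {s : A} (hs : s ∈ M) (hx : s • x ∈ localIntegralClosure M R) :
    x ∈ localIntegralClosure M R := by
  obtain ⟨t, ht, hx⟩ := hx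
  exact ⟨t * s, mul_mem ht hs, by rwa [mul_smul]⟩

theorem of_pow_mem {n : ℕ} (hn : 0 < n) (hx : x ^ n ∈ localIntegralClosure M R) :
    x ∈ localIntegralClosure M R := by
  obtain ⟨s, hs, hx⟩ := hx
  refine ⟨s, hs, .of_pow hn ?_⟩
  rw [smul_pow, ← Nat.sub_add_cancel hn, pow_succ s, mul_smul, Nat.sub_add_cancel hn]
  exact hx.smul _

theorem map_mem {F : Type*} [FunLike F R R'] [AlgHomClass F A R R'] (f : F)
    (hx : x ∈ localIntegralClosure M R) : f x ∈ localIntegralClosure M R' := by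
  obtain ⟨s, hs, hx⟩ := hx
  exact ⟨s, hs, by simpa only [map_smul] using hx.map f⟩

end localIntegralClosure

theorem isIntegral_of_forall_mem_localIntegralClosure {x : R}
    (h : ∀ (P : Ideal A) [P.IsMaximal], x ∈ localIntegralClosure P.primeCompl R) :
    IsIntegral A x := by
  let denominators : Ideal A := (integralClosure A R).toSubmodule.comap (.toSpanSingleton A R x)
  have hmem (s : A) : s ∈ denominators ↔ IsIntegral A (s • x) := by
    simp [denominators, mem_integralClosure_iff]
  suffices denominators = ⊤ by
    simpa using (hmem 1).mp (this ▸ Submodule.mem_top)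
  by_contra hne
  obtain ⟨P, hP, hle⟩ := Ideal.exists_le_maximal _ hne
  obtain ⟨s, hs, hx⟩ := h P
  exact hs (hle ((hmem s).mpr hx))

end LocalIntegralClosure

section PrimeNumber

variable {p : ℕ} [Fact p.Prime] {R : Type*} [CommRing R] {x : R}

/-- The elements of `R` that are integral at the prime number `p`. -/
abbrev integralAt (p : ℕ) [Fact p.Prime] (R : Type*) [CommRing R] : Subalgebra ℤ R :=
  localIntegralClosure (Ideal.span {(p : ℤ)}).primeCompl R

theorem mem_integralAt_of_smul_mem {m : ℤ} (hm : ¬ (p : ℤ) ∣ m) (hx : m • x ∈ integralAt p R) :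
    x ∈ integralAt p R :=
  localIntegralClosure.of_smul_mem (by rwa [Ideal.mem_primeCompl_iff, Ideal.mem_span_singleton]) hx

theorem isIntegral_of_forall_mem_integralAt
    (h : ∀ (p : ℕ) [Fact p.Prime], x ∈ integralAt p R) : IsIntegral ℤ x := by
  refine isIntegral_of_forall_mem_localIntegralClosure fun P hP ↦ ?_
  obtain rfl | ⟨p, hp, rfl⟩ := Ideal.isPrime_int_iff.mp hP.isPrime
  · exact absurd rfl (Ring.ne_bot_of_isMaximal_of_not_isField hP Int.not_isField)
  · have : Fact p.Prime := ⟨hp⟩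
    exact h p

end PrimeNumber

theorem exists_mem_smul_sub_zsmul_mem_of_dvd_index {G : Type*} [AddCommGroup G] {H : AddSubgroup G}
    {p : ℕ} [hp : Fact p.Prime] (hdvd : p ∣ H.index) (hsq : ¬ p ^ 2 ∣ H.index) :
    ∃ w ∉ H, p • w ∈ H ∧ ∃ m : ℕ, ¬ p ∣ m ∧ ∀ z, ∃ t : ℤ, m • z - t • w ∈ H := by
  have hindex : H.index ≠ 0 := fun h ↦ hsq (h ▸ dvd_zero _)
  have : Finite (G ⧸ H) := Nat.finite_of_card_ne_zero hindex
  obtain ⟨x, hx⟩ := exists_prime_addOrderOf_dvd_card' (G := G ⧸ H) p hdvd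
  obtain ⟨w, rfl⟩ := QuotientAddGroup.mk_surjective x
  let C := AddSubgroup.zmultiples (w : G ⧸ H)
  have hC : p * C.index = H.index := by
    rw [← hx, ← Nat.card_zmultiples, AddSubgroup.card_mul_index, AddSubgroup.index]
  refine ⟨w, fun hw ↦ ?_, ?_, C.index, fun h ↦ hsq ?_, fun z ↦ ?_⟩
  · rw [(QuotientAddGroup.eq_zero_iff w).mpr hw, addOrderOf_zero] at hx
    exact hp.out.ne_one hx.symm
  · rw [← QuotientAddGroup.eq_zero_iff, QuotientAddGroup.mk_nsmul, ← hx, addOrderOf_nsmul_eq_zero]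
  · rw [← hC, sq]
    exact mul_dvd_mul_left p h
  · obtain ⟨t, ht⟩ := AddSubgroup.mem_zmultiples_iff.mp (C.nsmul_index_mem (z : G ⧸ H))
    refine ⟨t, ?_⟩
    rw [← QuotientAddGroup.eq_zero_iff, QuotientAddGroup.mk_sub, QuotientAddGroup.mk_nsmul,
      QuotientAddGroup.mk_zsmul, ht, sub_self]

section InverseDifferent

theorem isIntegral_iff_mem_one {K : Type*} [Field K] {x : K} :
    IsIntegral ℤ x ↔ x ∈ (1 : FractionalIdeal (𝓞 K)⁰ K) := by
  rw [FractionalIdeal.mem_one_iff]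
  exact ⟨fun h ↦ ⟨⟨x, h⟩, rfl⟩, by rintro ⟨y, rfl⟩; exact y.2⟩

variable {K : Type*} [Field K] [NumberField K] {x y : K}

variable (K) in
/-- The inverse different of a number field: the dual of its ring of integers with respect to the
trace form. -/
noncomputable abbrev inverseDifferent : FractionalIdeal (𝓞 K)⁰ K :=
  FractionalIdeal.dual ℤ ℚ 1

variable (K) in
theorem inverseDifferent_ne_zero : inverseDifferent K ≠ 0 :=
  FractionalIdeal.dual_ne_zero ℤ ℚ (one_ne_zero (α := FractionalIdeal (𝓞 K)⁰ K))

theorem mem_inverseDifferent_iff :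
    x ∈ inverseDifferent K ↔
      ∀ y : K, IsIntegral ℤ y → ∃ n : ℤ, Algebra.trace ℚ K (x * y) = n := by
  rw [FractionalIdeal.mem_dual (one_ne_zero (α := FractionalIdeal (𝓞 K)⁰ K))]
  simp only [← isIntegral_iff_mem_one, Algebra.traceForm_apply, RingHom.mem_range, eq_intCast,
    eq_comm]

theorem isIntegral_of_forall_mem_inverseDifferent
    (h : ∀ z ∈ inverseDifferent K, ∃ n : ℤ, Algebra.trace ℚ K (x * z) = n) : IsIntegral ℤ x := by
  rw [isIntegral_iff_mem_one, ← FractionalIdeal.dual_dual ℤ ℚ (1 : FractionalIdeal (𝓞 K)⁰ K),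
    FractionalIdeal.mem_dual (inverseDifferent_ne_zero K)]
  intro z hz
  obtain ⟨n, hn⟩ := h z hz
  exact ⟨n, by simpa using hn.symm⟩

theorem mul_mem_inverseDifferent (hx : IsIntegral ℤ x) (hy : y ∈ inverseDifferent K) :
    x * y ∈ inverseDifferent K :=
  (inverseDifferent K : Submodule (𝓞 K) K).smul_mem ⟨x, hx⟩ hy

theorem isIntegral_mul_of_mem_differentIdeal {a : 𝓞 K} (ha : a ∈ differentIdeal ℤ (𝓞 K))
    (hx : x ∈ inverseDifferent K) : IsIntegral ℤ (a * x) := by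
  have hmul : (differentIdeal ℤ (𝓞 K) : FractionalIdeal (𝓞 K)⁰ K) * inverseDifferent K = 1 := by
    rw [coeIdeal_differentIdeal ℤ ℚ K (𝓞 K),
      inv_mul_cancel₀ (inverseDifferent_ne_zero K)]
  rw [isIntegral_iff_mem_one, ← hmul]
  exact FractionalIdeal.mul_mem_mul (FractionalIdeal.mem_coeIdeal_of_mem _ ha) hx

theorem isIntegral_integralBasis (i) : IsIntegral ℤ (NumberField.integralBasis K i) := by
  rw [NumberField.integralBasis_apply]
  exact NumberField.RingOfIntegers.isIntegral_coe _

theorem traceDual_integralBasis_mem_inverseDifferent (i) :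
    (NumberField.integralBasis K).traceDual i ∈ inverseDifferent K := by
  rw [mem_inverseDifferent_iff]
  intro y hy
  refine ⟨(NumberField.RingOfIntegers.basis K).repr ⟨y, hy⟩ i, ?_⟩
  rw [mul_comm, ← Algebra.traceForm_apply, ← Module.Basis.traceDual_repr_apply,
    Module.Basis.traceDual_traceDual]
  exact NumberField.integralBasis_repr_apply K ⟨y, hy⟩ i

theorem mem_span_traceDual_integralBasis_iff :
    x ∈ Submodule.span ℤ (Set.range (NumberField.integralBasis K).traceDual) ↔
      x ∈ inverseDifferent K := by
  refine ⟨fun hx ↦ ?_, fun hx ↦ ?_⟩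
  · suffices Submodule.span ℤ (Set.range (NumberField.integralBasis K).traceDual) ≤
        (inverseDifferent K : Submodule (𝓞 K) K).restrictScalars ℤ from this hx
    rw [Submodule.span_le, Set.range_subset_iff]
    exact traceDual_integralBasis_mem_inverseDifferent
  · rw [Module.Basis.mem_span_iff_repr_mem]
    intro i
    obtain ⟨n, hn⟩ := mem_inverseDifferent_iff.mp hx _ (isIntegral_integralBasis i)
    exact ⟨n, by simpa using hn.symm⟩

variable (K) in
theorem relIndex_one_inverseDifferent :
    (1 : FractionalIdeal (𝓞 K)⁰ K).coeToSubmodule.toAddSubgroup.relIndex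
      (inverseDifferent K).coeToSubmodule.toAddSubgroup = (NumberField.discr K).natAbs := by
  let b := NumberField.integralBasis K
  have hdet : b.traceDual.det b = NumberField.discr K := by
    rw [NumberField.coe_discr, Algebra.discr_def, Module.Basis.det_apply]
    congr 1
    ext i j
    rw [Module.Basis.toMatrix_apply, Module.Basis.traceDual_repr_apply, Algebra.traceMatrix_apply,
      Algebra.traceForm_apply, Algebra.traceForm_apply, mul_comm]
  rw [← Nat.cast_inj (R := ℚ), AddSubgroup.relIndex_eq_abs_det _ _ ?_ b b.traceDual ?_ ?_, hdet,
    Nat.cast_natAbs, Int.cast_abs]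
  · exact FractionalIdeal.one_le_dual_one ℤ ℚ
  · ext x
    rw [← Submodule.span_int_eq_addSubgroupClosure, Submodule.mem_toAddSubgroup,
      Submodule.mem_toAddSubgroup, NumberField.mem_span_integralBasis]
    simp
  · ext x
    rw [← Submodule.span_int_eq_addSubgroupClosure, Submodule.mem_toAddSubgroup,
      Submodule.mem_toAddSubgroup, mem_span_traceDual_integralBasis_iff]
    rfl

end InverseDifferent

section Splitting

variable {K : Type*} [Field K] [NumberField K] {p : ℕ} [Fact p.Prime]

theorem map_mem_integralAt_of_forall_isIntegral {R : Type*} [CommRing R] [Algebra ℚ R]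
    {f : K →ₗ[ℚ] R} (hf : ∀ y, IsIntegral ℤ y → f y ∈ integralAt p R) {x : K}
    (hx : x ∈ integralAt p K) : f x ∈ integralAt p R := by
  obtain ⟨m, hm, hx⟩ := hx
  exact localIntegralClosure.of_smul_mem hm (map_zsmul f m x ▸ hf _ hx)

theorem integralBasis_repr_mem_integralAt {x : K} (hx : x ∈ integralAt p K) (i) :
    (NumberField.integralBasis K).repr x i ∈ integralAt p ℚ := by
  refine map_mem_integralAt_of_forall_isIntegral
    (f := (NumberField.integralBasis K).coord i) (fun y hy ↦ ?_) hx
  have h := NumberField.integralBasis_repr_apply K ⟨y, hy⟩ i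
  rw [Module.Basis.coord_apply]
  exact h ▸ localIntegralClosure.mem_of_isIntegral isIntegral_algebraMap

theorem trace_mem_integralAt {f : K →ₗ[ℚ] K} (hf : ∀ y, IsIntegral ℤ y → f y ∈ integralAt p K) :
    LinearMap.trace ℚ K f ∈ integralAt p ℚ := by
  rw [LinearMap.trace_eq_matrix_trace ℚ (NumberField.integralBasis K)]
  refine sum_mem fun i _ ↦ ?_
  rw [Matrix.diag_apply, LinearMap.toMatrix_apply]
  exact integralBasis_repr_mem_integralAt (hf _ (isIntegral_integralBasis i)) i

/-- A rank-one splitting of the inverse different at `p`: modulo elements integral at `p`, every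
`z` in the inverse different equals `s * tr (z * w) • w`. If `p` divides the discriminant exactly
once, `s` is the inverse of `tr (w * w)` and this is the orthogonal projection onto the line through
`w`; if `p` is unramified, `w = 0`. -/
structure IsSplittingAt (p : ℕ) [Fact p.Prime] (w : K) (s : ℚ) : Prop where
  mem_inverseDifferent : w ∈ inverseDifferent K
  smul_mem : s • w ∈ integralAt p K
  sub_smul_mem : ∀ z ∈ inverseDifferent K, z - (s * Algebra.trace ℚ K (z * w)) • w ∈ integralAt p K

theorem isSplittingAt_zero (hp : ¬ (p : ℤ) ∣ NumberField.discr K) :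
    IsSplittingAt p (0 : K) 0 where
  mem_inverseDifferent := zero_mem (inverseDifferent K).coeToSubmodule
  smul_mem := by rw [smul_zero]; exact zero_mem _
  sub_smul_mem z hz := by
    rw [smul_zero, sub_zero]
    refine mem_integralAt_of_smul_mem hp (localIntegralClosure.mem_of_isIntegral ?_)
    simpa using
      isIntegral_mul_of_mem_differentIdeal (NumberField.discr_mem_differentIdeal K (𝓞 K)) hz

variable (K) in
theorem exists_zsmul_sub_isIntegral (hp : (p : ℤ) ∣ NumberField.discr K)
    (hp2 : ¬ (p : ℤ) ^ 2 ∣ NumberField.discr K) :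
    ∃ w ∈ inverseDifferent K, ¬ IsIntegral ℤ w ∧ IsIntegral ℤ ((p : ℤ) • w) ∧
      ∃ m : ℤ, ¬ (p : ℤ) ∣ m ∧
        ∀ z ∈ inverseDifferent K, ∃ t : ℤ, IsIntegral ℤ (m • z - t • w) := by
  let H := (1 : FractionalIdeal (𝓞 K)⁰ K).coeToSubmodule.toAddSubgroup.addSubgroupOf
    (inverseDifferent K).coeToSubmodule.toAddSubgroup
  have hindex : H.index = (NumberField.discr K).natAbs := relIndex_one_inverseDifferent K
  have hH (z) : z ∈ H ↔ IsIntegral ℤ (z : K) := isIntegral_iff_mem_one.symm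
  obtain ⟨w, hw, hpw, m, hm, hz⟩ := exists_mem_smul_sub_zsmul_mem_of_dvd_index (H := H) (p := p)
    (by rwa [hindex, ← Int.natCast_dvd])
    (by rw [hindex, ← Int.natCast_dvd]; exact_mod_cast hp2)
  simp only [hH] at hw hpw hz
  refine ⟨w, w.2, hw, by simpa using hpw, m, by rwa [Int.natCast_dvd_natCast], fun z hzD ↦ ?_⟩
  obtain ⟨t, ht⟩ := hz ⟨z, hzD⟩
  exact ⟨t, by simpa using ht⟩

theorem not_dvd_trace_mul_zsmul {w : K} {m u : ℤ} (hw : w ∈ inverseDifferent K)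
    (hwint : ¬ IsIntegral ℤ w) (hpw : IsIntegral ℤ ((p : ℤ) • w)) (hm : ¬ (p : ℤ) ∣ m)
    (hmz : ∀ z ∈ inverseDifferent K, ∃ t : ℤ, IsIntegral ℤ (m • z - t • w))
    (hu : Algebra.trace ℚ K (w * (p : ℤ) • w) = u) : ¬ (p : ℤ) ∣ u := by
  have hpZ : Prime (p : ℤ) := Nat.prime_iff_prime_int.mp Fact.out
  rintro ⟨v, rfl⟩
  have hv : Algebra.trace ℚ K (w * w) = v := by
    rw [mul_smul_comm, map_zsmul, zsmul_eq_mul, Int.cast_mul] at hu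
    exact mul_left_cancel₀ (Int.cast_ne_zero.mpr hpZ.ne_zero) hu
  have hmw : IsIntegral ℤ (m • w) := by
    refine isIntegral_of_forall_mem_inverseDifferent fun z hz ↦ ?_
    obtain ⟨t, ht⟩ := hmz z hz
    obtain ⟨n, hn⟩ := mem_inverseDifferent_iff.mp hw _ ht
    refine ⟨n + t * v, ?_⟩
    rw [smul_mul_assoc, ← mul_smul_comm, ← sub_add_cancel (m • z) (t • w), mul_add, map_add, hn,
      mul_smul_comm, map_zsmul, hv, zsmul_eq_mul, Int.cast_add, Int.cast_mul]
  obtain ⟨a, b, hab⟩ := (hpZ.coprime_iff_not_dvd (n := m)).mpr hm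
  refine hwint ?_
  rw [← one_zsmul w, ← hab, add_smul, mul_smul, mul_smul]
  exact (hpw.smul a).add (hmw.smul b)

theorem exists_isSplittingAt_of_dvd (hp : (p : ℤ) ∣ NumberField.discr K)
    (hp2 : ¬ (p : ℤ) ^ 2 ∣ NumberField.discr K) :
    ∃ (w : K) (s : ℚ), IsSplittingAt p w s := by
  obtain ⟨w, hw, hwint, hpw, m, hm, hmz⟩ := exists_zsmul_sub_isIntegral K hp hp2
  obtain ⟨u, hu⟩ := mem_inverseDifferent_iff.mp hw _ hpw
  have hpu := not_dvd_trace_mul_zsmul hw hwint hpw hm hmz hu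
  have hu0 : (u : ℚ) ≠ 0 := Int.cast_ne_zero.mpr fun h ↦ hpu (h ▸ dvd_zero _)
  have hsw : (p / u : ℚ) • w ∈ integralAt p K := by
    refine mem_integralAt_of_smul_mem hpu (localIntegralClosure.mem_of_isIntegral ?_)
    rwa [← Int.cast_smul_eq_zsmul ℚ, smul_smul, mul_div_cancel₀ _ hu0, ← Int.cast_natCast,
      Int.cast_smul_eq_zsmul]
  refine ⟨w, p / u, hw, hsw, fun z hz ↦ ?_⟩
  obtain ⟨t, ha⟩ := hmz z hz
  obtain ⟨n, hn⟩ := mem_inverseDifferent_iff.mp hw _ ha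
  have htrace : m * (p / u * Algebra.trace ℚ K (z * w)) = t + n * (p / u) := by
    have hsq : p * Algebra.trace ℚ K (w * w) = u := by
      rwa [mul_smul_comm, map_zsmul, zsmul_eq_mul, Int.cast_natCast] at hu
    have hzw : m * Algebra.trace ℚ K (z * w) = n + t * Algebra.trace ℚ K (w * w) := by
      rw [← hn, mul_sub, map_sub, mul_smul_comm, mul_smul_comm, map_zsmul, map_zsmul, zsmul_eq_mul,
        zsmul_eq_mul, sub_add_cancel, mul_comm w z]
    field_simp
    linear_combination p * hzw + t * hsq
  refine mem_integralAt_of_smul_mem hm ?_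
  have hsplit : m • (z - (p / u * Algebra.trace ℚ K (z * w)) • w) =
      (m • z - t • w) - n • (p / u : ℚ) • w := by
    rw [smul_sub, ← Int.cast_smul_eq_zsmul ℚ m (_ • w), smul_smul, htrace, add_smul, mul_smul,
      Int.cast_smul_eq_zsmul, Int.cast_smul_eq_zsmul, sub_sub]
  rw [hsplit]
  exact sub_mem (localIntegralClosure.mem_of_isIntegral ha) (zsmul_mem hsw n)

theorem exists_isSplittingAt (hp2 : ¬ (p : ℤ) ^ 2 ∣ NumberField.discr K) :
    ∃ (w : K) (s : ℚ), IsSplittingAt p w s := by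
  by_cases hp : (p : ℤ) ∣ NumberField.discr K
  · exact exists_isSplittingAt_of_dvd hp hp2
  · exact ⟨0, 0, isSplittingAt_zero hp⟩

theorem IsSplittingAt.smul_mul_self_mem {w : K} {s : ℚ} (h : IsSplittingAt p w s) :
    s • (w * w) ∈ integralAt p K := by
  let f : K →ₗ[ℚ] K := LinearMap.mul ℚ K w -
    (Algebra.traceForm ℚ K (w * w)).smulRight (s • w)
  have hf (y : K) : f y = w * y - (s * Algebra.trace ℚ K (w * y * w)) • w := by
    simp [f, smul_smul, mul_comm, mul_left_comm]
  have hfint (y : K) (hy : IsIntegral ℤ y) : f y ∈ integralAt p K := by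
    rw [hf, mul_comm w y]
    exact h.sub_smul_mem _ (mul_mem_inverseDifferent hy h.mem_inverseDifferent)
  obtain ⟨n, hn⟩ := mem_inverseDifferent_iff.mp h.mem_inverseDifferent 1 isIntegral_one
  have htrace : LinearMap.trace ℚ K f = n - s * Algebra.trace ℚ K (w * w * w) := by
    rw [map_sub, LinearMap.trace_smulRight, ← hn, mul_one]
    simp [Algebra.trace_apply]
  have hcube : s * Algebra.trace ℚ K (w * w * w) ∈ integralAt p ℚ := by
    have := sub_mem (intCast_mem (integralAt p ℚ) n) (trace_mem_integralAt hfint)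
    rwa [htrace, sub_sub_cancel] at this
  have hfw : f (s • w) = s • (w * w) -
      algebraMap ℚ K (s * Algebra.trace ℚ K (w * w * w)) * (s • w) := by
    rw [hf, ← Algebra.smul_def, mul_smul_comm, smul_mul_assoc, map_smul, smul_eq_mul, smul_smul,
      mul_comm s (s * _)]
  rw [eq_add_of_sub_eq hfw.symm]
  exact add_mem (map_mem_integralAt_of_forall_isIntegral hfint h.smul_mem)
    (mul_mem (localIntegralClosure.map_mem (algebraMap ℚ K).toIntAlgHom hcube) h.smul_mem)

end Splitting

section TameRamification

theorem exists_trace_ne_zero_of_isNilpotent {k R : Type*} [Field k] [CommRing R] [Algebra k R]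
    [Finite R] (I : Ideal R) [I.IsMaximal] (hI : IsNilpotent I) {e : ℕ}
    (hcard : Nat.card R = Nat.card (R ⧸ I) ^ e) (he : (e : k) ≠ 0) :
    ∃ x : R, Algebra.trace k R x ≠ 0 := by
  let : Field (R ⧸ I) := Ideal.Quotient.field I
  have : Nontrivial R := (Ideal.Quotient.mk_surjective (I := I)).nontrivial
  have : Finite k := Finite.of_injective _ (algebraMap k R).injective
  have : Finite (R ⧸ I) := .of_surjective _ Ideal.Quotient.mk_surjective
  -- The residue field is formally smooth over `k`, so it lifts to a subfield of `R`, over which `R`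
  -- has dimension `e`; on that subfield the trace of `R` is `e` times the trace of `R ⧸ I`.
  obtain ⟨lift, -⟩ := Algebra.FormallySmooth.exists_lift I hI (AlgHom.id k (R ⧸ I))
  let := lift.toRingHom.toAlgebra
  have : IsScalarTower k (R ⧸ I) R := .of_algebraMap_eq fun x ↦ (lift.commutes x).symm
  have hrank : Module.finrank (R ⧸ I) R = e := by
    have h := Module.natCard_eq_pow_finrank (K := R ⧸ I) (V := R)
    rw [hcard] at h
    exact (Nat.pow_right_injective (Finite.one_lt_card : 1 < Nat.card (R ⧸ I)) h).symm
  obtain ⟨y, hy⟩ : ∃ y, Algebra.trace k (R ⧸ I) y ≠ 0 := by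
    simpa [LinearMap.ext_iff] using Algebra.trace_ne_zero k (R ⧸ I)
  refine ⟨algebraMap (R ⧸ I) R y, ?_⟩
  rw [← Algebra.trace_trace (S := R ⧸ I), Algebra.trace_algebraMap, hrank, map_nsmul,
    nsmul_eq_mul]
  exact mul_ne_zero he hy

attribute [local instance] FractionRing.liftAlgebra FractionRing.isScalarTower_liftAlgebra
  Ideal.Quotient.field

variable {A B : Type*} [CommRing A] [CommRing B] [Algebra A B] [IsDedekindDomain A]
  [IsDedekindDomain B] [Module.IsTorsionFree A B] [Module.Finite A B]
  {p : Ideal A} [p.IsMaximal] {P Q : Ideal B}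

theorem mk_intTrace_eq_add_of_isCoprime [Algebra (A ⧸ p) (B ⧸ P)] [Algebra (A ⧸ p) (B ⧸ Q)]
    [IsScalarTower A (A ⧸ p) (B ⧸ P)] [IsScalarTower A (A ⧸ p) (B ⧸ Q)]
    (hPQ : IsCoprime P Q) (hmap : p.map (algebraMap A B) = P * Q) (y : B) :
    Ideal.Quotient.mk p (Algebra.intTrace A B y) =
      Algebra.trace (A ⧸ p) (B ⧸ P) (Ideal.Quotient.mk P y) +
        Algebra.trace (A ⧸ p) (B ⧸ Q) (Ideal.Quotient.mk Q y) := by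
  have : Module.Finite (A ⧸ p) (B ⧸ P) := .of_restrictScalars_finite A _ _
  have : Module.Finite (A ⧸ p) (B ⧸ Q) := .of_restrictScalars_finite A _ _
  let crt : (B ⧸ p.map (algebraMap A B)) ≃+* (B ⧸ P) × B ⧸ Q :=
    (Ideal.quotEquivOfEq hmap).trans (Ideal.quotientMulEquivQuotientProd P Q hPQ)
  let f : (B ⧸ p.map (algebraMap A B)) ≃ₐ[A ⧸ p] (B ⧸ P) × B ⧸ Q :=
    AlgEquiv.ofRingEquiv (f := crt) <| Quotient.ind fun a ↦ Prod.ext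
      (IsScalarTower.algebraMap_apply A (A ⧸ p) (B ⧸ P) a)
      (IsScalarTower.algebraMap_apply A (A ⧸ p) (B ⧸ Q) a)
  rw [← Algebra.trace_quotient_eq_of_isDedekindDomain, ← Algebra.trace_eq_of_algEquiv f,
    Algebra.trace_prod_apply]
  rfl

variable [Algebra.IsSeparable (FractionRing A) (FractionRing B)]

theorem not_dvd_differentIdeal_of_trace_ne_zero [Algebra (A ⧸ p) (B ⧸ P)]
    [IsScalarTower A (A ⧸ p) (B ⧸ P)] (hPQ : IsCoprime P Q)
    (hmap : p.map (algebraMap A B) = P * Q) {x : B ⧸ P}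
    (hx : Algebra.trace (A ⧸ p) (B ⧸ P) x ≠ 0) : ¬ P ∣ differentIdeal A B := by
  have hpQ : p.map (algebraMap A B) ≤ Q := hmap ▸ Ideal.mul_le_right
  let : Algebra (A ⧸ p) (B ⧸ Q) :=
    Ideal.Quotient.algebraQuotientOfLEComap (Ideal.map_le_iff_le_comap.mp hpQ)
  have : IsScalarTower A (A ⧸ p) (B ⧸ Q) := .of_algebraMap_eq' rfl
  obtain ⟨x, rfl⟩ := Ideal.Quotient.mk_surjective x
  obtain ⟨a, ha, b, hb, hab⟩ := Ideal.isCoprime_iff_exists.mp hPQ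
  have hxb : Ideal.Quotient.mk P (x * b) = Ideal.Quotient.mk P x := by
    rw [Ideal.Quotient.mk_eq_mk_iff_sub_mem, show x * b - x = -x * a by linear_combination x * hab]
    exact P.mul_mem_left _ ha
  have hxbQ : x * b ∈ Q := Q.mul_mem_left x hb
  refine not_dvd_differentIdeal_of_intTrace_not_mem A P Q hmap.symm (x * b) hxbQ ?_
  rwa [← Ideal.Quotient.eq_zero_iff_mem, mk_intTrace_eq_add_of_isCoprime hPQ hmap, hxb,
    Ideal.Quotient.eq_zero_iff_mem.mpr hxbQ, map_zero, add_zero]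

theorem not_pow_dvd_differentIdeal_of_isCoprime [Finite (A ⧸ p)] [P.IsMaximal] {e : ℕ}
    (hP : P ≠ ⊥) (hPQ : IsCoprime P Q) (hmap : p.map (algebraMap A B) = P ^ e * Q)
    (he : (e : A) ∉ p) : ¬ P ^ e ∣ differentIdeal A B := by
  have hpP : p.map (algebraMap A B) ≤ P ^ e := hmap ▸ Ideal.mul_le_left
  let : Algebra (A ⧸ p) (B ⧸ P ^ e) :=
    Ideal.Quotient.algebraQuotientOfLEComap (Ideal.map_le_iff_le_comap.mp hpP)
  have : IsScalarTower A (A ⧸ p) (B ⧸ P ^ e) := .of_algebraMap_eq' rfl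
  have : Module.Finite (A ⧸ p) (B ⧸ P ^ e) := .of_restrictScalars_finite A _ _
  have : Finite (B ⧸ P ^ e) := Module.finite_of_finite (A ⧸ p)
  have he0 : e ≠ 0 := by rintro rfl; exact he (by simp)
  let I := P.map (Ideal.Quotient.mk (P ^ e))
  have hI : I.IsMaximal :=
    .map_of_surjective_of_ker_le Ideal.Quotient.mk_surjective (by simpa using Ideal.pow_le_self he0)
  have hnil : IsNilpotent I := ⟨e, by rw [← Ideal.map_pow, Ideal.map_quotient_self]; rfl⟩
  have hcard : Nat.card (B ⧸ P ^ e) = Nat.card ((B ⧸ P ^ e) ⧸ I) ^ e := by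
    rw [Nat.card_congr (DoubleQuot.quotQuotEquivQuotOfLE (Ideal.pow_le_self he0)).toEquiv]
    exact cardQuot_pow_of_prime hP
  obtain ⟨x, hx⟩ := exists_trace_ne_zero_of_isNilpotent (k := A ⧸ p) I hnil hcard
    (by rwa [← map_natCast (Ideal.Quotient.mk p), ne_eq, Ideal.Quotient.eq_zero_iff_mem])
  exact not_dvd_differentIdeal_of_trace_ne_zero hPQ.pow_left hmap hx

theorem emultiplicity_differentIdeal_lt [Finite (A ⧸ p)] [P.IsMaximal]
    (hp : p.map (algebraMap A B) ≠ ⊥) (he : (Ideal.ramificationIdx' p P : A) ∉ p) :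
    emultiplicity P (differentIdeal A B) < emultiplicity P (p.map (algebraMap A B)) := by
  have hP : P ≠ ⊥ := by
    rintro rfl
    rw [Ideal.ramificationIdx'_of_not_le (mt le_bot_iff.mp hp), Nat.cast_zero] at he
    exact he p.zero_mem
  have hprime : Prime P := Ideal.prime_of_isPrime hP ‹P.IsMaximal›.isPrime
  have hfin : FiniteMultiplicity P (p.map (algebraMap A B)) := .of_prime_left hprime hp
  obtain ⟨Q, hmap, hQ⟩ := hfin.exists_eq_pow_mul_and_not_dvd
  have hPQ : IsCoprime P Q := by
    rwa [← hprime.irreducible.gcd_eq_one_iff, ← Ideal.isCoprime_iff_gcd] at hQ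
  rw [Ideal.IsDedekindDomain.ramificationIdx'_eq_multiplicity hp ‹P.IsMaximal›.isPrime] at he
  rw [hfin.emultiplicity_eq_multiplicity, emultiplicity_lt_iff_not_dvd]
  exact not_pow_dvd_differentIdeal_of_isCoprime hP hPQ hmap he

section NumberField

variable {K : Type*} [Field K] [NumberField K] {p : ℕ} [hp : Fact p.Prime]

theorem emultiplicity_differentIdeal_lt_of_tame {Q : Ideal (𝓞 K)} [Q.IsMaximal]
    (htame : ¬ p ∣ Ideal.ramificationIdx' (Ideal.span {(p : ℤ)}) Q) :
    emultiplicity Q (differentIdeal ℤ (𝓞 K)) < emultiplicity Q (Ideal.span {(p : 𝓞 K)}) := by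
  have hmap : (Ideal.span {(p : ℤ)}).map (algebraMap ℤ (𝓞 K)) = Ideal.span {(p : 𝓞 K)} := by
    rw [Ideal.map_span, Set.image_singleton, map_natCast]
  have : Finite (ℤ ⧸ Ideal.span {(p : ℤ)}) :=
    .of_equiv _ (Int.quotientSpanNatEquivZMod p).symm.toEquiv
  rw [← hmap]
  apply emultiplicity_differentIdeal_lt
  · rw [hmap, ne_eq, Ideal.span_singleton_eq_bot]
    exact_mod_cast hp.out.ne_zero
  · rwa [Ideal.mem_span_singleton, Int.natCast_dvd_natCast]

theorem exists_mul_mem_differentIdeal_of_tame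
    (htame : ∀ P : Ideal (𝓞 K), P.IsPrime → P.LiesOver (Ideal.span {(p : ℤ)}) →
      ¬ p ∣ Ideal.ramificationIdx' (Ideal.span {(p : ℤ)}) P) :
    ∃ m : ℤ, ¬ (p : ℤ) ∣ m ∧ ((m * p : ℤ) : 𝓞 K) ∈ differentIdeal ℤ (𝓞 K) := by
  have hpZ : Prime (p : ℤ) := Nat.prime_iff_prime_int.mp hp.out
  obtain ⟨m, hd, hm⟩ := (FiniteMultiplicity.of_prime_left hpZ
    (NumberField.discr_ne_zero K)).exists_eq_pow_mul_and_not_dvd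
  refine ⟨m, hm, ?_⟩
  have hdvd : differentIdeal ℤ (𝓞 K) ∣
      Ideal.span {(p : 𝓞 K)} ^ multiplicity (p : ℤ) (NumberField.discr K) *
        Ideal.span {(m : 𝓞 K)} := by
    have hmem := NumberField.discr_mem_differentIdeal K (𝓞 K)
    rw [hd] at hmem
    rw [Ideal.span_singleton_pow, Ideal.span_singleton_mul_span_singleton, Ideal.dvd_span_singleton]
    exact_mod_cast hmem
  rw [Int.cast_mul, Int.cast_natCast, ← Ideal.dvd_span_singleton,
    ← Ideal.span_singleton_mul_span_singleton,
    UniqueFactorizationMonoid.dvd_iff_emultiplicity_le differentIdeal_ne_bot]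
  intro Q hQ
  have hQp : Q.IsPrime := Ideal.isPrime_of_prime hQ
  have : Q.IsMaximal := hQp.isMaximal hQ.ne_zero
  rw [emultiplicity_mul hQ]
  by_cases hpQ : (p : 𝓞 K) ∈ Q
  · have hlies : Q.LiesOver (Ideal.span {(p : ℤ)}) :=
      (Ideal.liesOver_span_iff hQp.ne_top hpZ).mpr (by simpa using hpQ)
    exact (emultiplicity_differentIdeal_lt_of_tame (htame Q hQp hlies)).le.trans le_add_self
  · refine (emultiplicity_le_emultiplicity_of_dvd_right hdvd).trans (le_of_eq_of_le ?_ le_self_add)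
    rw [emultiplicity_mul hQ, emultiplicity_pow hQ,
      emultiplicity_eq_zero.mpr (mt Ideal.dvd_span_singleton.mp hpQ), mul_zero, zero_add]

end NumberField

end TameRamification

namespace IsIntegralTraceIsometry

variable {K L : Type*} [Field K] [NumberField K] [Field L] [NumberField L] {φ : K ≃ₗ[ℚ] L}
  {p : ℕ} [Fact p.Prime] {x : K}

theorem isIntegral_iff (hφ : IsIntegralTraceIsometry φ) : IsIntegral ℤ (φ x) ↔ IsIntegral ℤ x := by
  change φ x ∈ {y : L | IsIntegral ℤ y} ↔ x ∈ {x : K | IsIntegral ℤ x}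
  rw [← hφ.image_integers, φ.injective.mem_set_image]

theorem map_mem_integralAt (hφ : IsIntegralTraceIsometry φ) (hx : x ∈ integralAt p K) :
    φ x ∈ integralAt p L :=
  map_mem_integralAt_of_forall_isIntegral (f := φ.toLinearMap)
    (fun _ hy ↦ localIntegralClosure.mem_of_isIntegral (hφ.isIntegral_iff.mpr hy)) hx

theorem map_mem_inverseDifferent_iff (hφ : IsIntegralTraceIsometry φ) :
    φ x ∈ inverseDifferent L ↔ x ∈ inverseDifferent K := by
  simp only [mem_inverseDifferent_iff, φ.surjective.forall, hφ.isIntegral_iff, hφ.trace_eq]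

theorem isSplittingAt (hφ : IsIntegralTraceIsometry φ) {w : K} {s : ℚ} (h : IsSplittingAt p w s) :
    IsSplittingAt p (φ w) s where
  mem_inverseDifferent := hφ.map_mem_inverseDifferent_iff.mpr h.mem_inverseDifferent
  smul_mem := map_smul φ s w ▸ hφ.map_mem_integralAt h.smul_mem
  sub_smul_mem := by
    simp only [φ.surjective.forall, hφ.map_mem_inverseDifferent_iff, hφ.trace_eq, ← map_smul,
      ← map_sub]
    exact fun z hz ↦ hφ.map_mem_integralAt (h.sub_smul_mem z hz)

end IsIntegralTraceIsometry

section CasimirPairing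

section General

variable {F K R : Type*} [Field F] [Field K] [Algebra F K] [FiniteDimensional F K]
  [Algebra.IsSeparable F K] [Ring R] [Algebra F R]

theorem traceCasimirPairing_eq_sum {ι : Type*} [Fintype ι] [DecidableEq ι]
    (b : Module.Basis ι F K) (ψ φ : K →ₗ[F] R) :
    traceCasimirPairing F K ψ φ = ∑ i, ψ (b.traceDual i) * φ (b i) := by
  have hone : (1 : Module.End F K) = dualTensorHomEquiv F K K (∑ i, b.dualBasis i ⊗ₜ[F] b i) := by
    rw [dualTensorHomEquiv_eq_dualTensorHomEquivOfBasis b, dualTensorHomEquivOfBasis_apply]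
    ext x
    simp [dualTensorHom_apply, b.sum_repr]
  have hdual (i) : (LinearMap.BilinForm.toDual (Algebra.traceForm F K)
      (traceForm_nondegenerate F K)).symm (b.dualBasis i) = b.traceDual i := rfl
  rw [traceCasimirPairing, casimirPairing, casimirRho, hone]
  simp only [LinearMap.comp_apply, LinearEquiv.coe_coe, LinearEquiv.symm_apply_apply, map_sum,
    TensorProduct.lift.tmul, LinearMap.compl₁₂_apply, LinearMap.mul_apply', hdual]

theorem traceCasimirPairing_add_left (ψ ψ' φ : K →ₗ[F] R) :
    traceCasimirPairing F K (ψ + ψ') φ =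
      traceCasimirPairing F K ψ φ + traceCasimirPairing F K ψ' φ := by
  simp only [traceCasimirPairing_eq_sum (Module.finBasis F K), LinearMap.add_apply, add_mul,
    Finset.sum_add_distrib]

theorem traceCasimirPairing_smul_left (a : F) (ψ φ : K →ₗ[F] R) :
    traceCasimirPairing F K (a • ψ) φ = a • traceCasimirPairing F K ψ φ := by
  simp only [traceCasimirPairing_eq_sum (Module.finBasis F K), LinearMap.smul_apply, smul_mul_assoc,
    Finset.smul_sum]

theorem traceCasimirPairing_smulRight (x : K) (r : R) (φ : K →ₗ[F] R) :
    traceCasimirPairing F K ((Algebra.traceForm F K x).smulRight r) φ = r * φ x := by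
  let b := Module.finBasis F K
  have hx : φ x = ∑ i, Algebra.traceForm F K x (b.traceDual i) • φ (b i) := by
    conv_lhs => rw [← b.sum_repr x, map_sum]
    refine Finset.sum_congr rfl fun i _ ↦ ?_
    rw [map_smul, ← Module.Basis.traceDual_repr_apply, Module.Basis.traceDual_traceDual]
  rw [traceCasimirPairing_eq_sum b, hx, Finset.mul_sum]
  simp only [LinearMap.smulRight_apply, smul_mul_assoc, mul_smul_comm]

end General

theorem traceCasimirPairing_mem {K R : Type*} [Field K] [NumberField K] [Ring R] [Algebra ℚ R]
    (S : Subring R) {ψ φ : K →ₗ[ℚ] R} (hψ : ∀ z ∈ inverseDifferent K, ψ z ∈ S)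
    (hφ : ∀ x, IsIntegral ℤ x → φ x ∈ S) :
    traceCasimirPairing ℚ K ψ φ ∈ S := by
  rw [traceCasimirPairing_eq_sum (NumberField.integralBasis K)]
  exact sum_mem fun i _ ↦ mul_mem (hψ _ (traceDual_integralBasis_mem_inverseDifferent i))
    (hφ _ (isIntegral_integralBasis i))

variable {K L R : Type*} [Field K] [NumberField K] [Field L] [NumberField L] [CommRing R]
  [Algebra ℚ R]

theorem isIntegral_zsmul_traceCasimirPairing (ψ : K →ₐ[ℚ] R) {φ : K →ₗ[ℚ] R}
    (hφ : ∀ x, IsIntegral ℤ x → IsIntegral ℤ (φ x)) {n : ℤ}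
    (hn : (n : 𝓞 K) ∈ differentIdeal ℤ (𝓞 K)) :
    IsIntegral ℤ (n • traceCasimirPairing ℚ K ψ.toLinearMap φ) := by
  rw [← Int.cast_smul_eq_zsmul ℚ, ← traceCasimirPairing_smul_left]
  refine traceCasimirPairing_mem (integralClosure ℤ R).toSubring (fun z hz ↦ ?_) hφ
  have hnz : IsIntegral ℤ ((n : ℚ) • z) := by
    simpa [Algebra.smul_def] using isIntegral_mul_of_mem_differentIdeal hn hz
  have := hnz.map ψ
  rwa [map_smul] at this

theorem IsIntegralTraceIsometry.traceCasimirPairing_mem_integralAt {φ : K ≃ₗ[ℚ] L}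
    (hφ : IsIntegralTraceIsometry φ) (ιK : K →ₐ[ℚ] R) (ιL : L →ₐ[ℚ] R) {p : ℕ} [Fact p.Prime]
    (hp2 : ¬ (p : ℤ) ^ 2 ∣ NumberField.discr K) :
    traceCasimirPairing ℚ K ιK.toLinearMap (ιL.toLinearMap ∘ₗ φ.toLinearMap) ∈ integralAt p R := by
  obtain ⟨w, s, h⟩ := exists_isSplittingAt (K := K) hp2
  let f := (Algebra.traceForm ℚ K w).smulRight (s • ιK w)
  have hsplit : ιK.toLinearMap = (ιK.toLinearMap - f) + f := (sub_add_cancel _ _).symm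
  rw [hsplit, traceCasimirPairing_add_left, traceCasimirPairing_smulRight]
  refine add_mem (traceCasimirPairing_mem (integralAt p R).toSubring (fun z hz ↦ ?_) fun x hx ↦ ?_)
    (localIntegralClosure.of_pow_mem two_pos ?_)
  · have hf : (ιK.toLinearMap - f) z = ιK (z - (s * Algebra.trace ℚ K (z * w)) • w) := by
      simp [f, smul_smul, mul_comm]
    rw [hf]
    exact localIntegralClosure.map_mem (ιK.restrictScalars ℤ) (h.sub_smul_mem z hz)
  · exact localIntegralClosure.mem_of_isIntegral
      ((hφ.isIntegral_iff.mpr hx).map (ιL.restrictScalars ℤ))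
  · have hsq : (s • ιK w * (ιL.toLinearMap ∘ₗ φ.toLinearMap) w) ^ 2 =
        ιK (s • (w * w)) * ιL (s • (φ w * φ w)) := by
      simp only [LinearMap.comp_apply, LinearEquiv.coe_coe, AlgHom.toLinearMap_apply,
        Algebra.smul_def, map_mul, AlgHom.commutes]
      ring
    rw [hsq]
    exact mul_mem
      (localIntegralClosure.map_mem (ιK.restrictScalars ℤ) h.smul_mul_self_mem)
      (localIntegralClosure.map_mem (ιL.restrictScalars ℤ) (hφ.isSplittingAt h).smul_mul_self_mem)

theorem IsIntegralTraceIsometry.isIntegral_intCast_mul_traceCasimirPairing {φ : K ≃ₗ[ℚ] L}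
    (hφ : IsIntegralTraceIsometry φ) (ιK : K →ₐ[ℚ] R) (ιL : L →ₐ[ℚ] R) (n : ℤ)
    (h : ∀ (p : ℕ) [Fact p.Prime], (p : ℤ) ^ 2 ∣ NumberField.discr K →
      n * traceCasimirPairing ℚ K ιK.toLinearMap (ιL.toLinearMap ∘ₗ φ.toLinearMap) ∈
        integralAt p R) :
    IsIntegral ℤ
      (n * traceCasimirPairing ℚ K ιK.toLinearMap (ιL.toLinearMap ∘ₗ φ.toLinearMap)) := by
  refine isIntegral_of_forall_mem_integralAt fun p _ ↦ ?_
  by_cases hp2 : (p : ℤ) ^ 2 ∣ NumberField.discr K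
  · exact h p hp2
  · exact mul_mem (intCast_mem _ n) (hφ.traceCasimirPairing_mem_integralAt ιK ιL hp2)

end CasimirPairing

theorem not_dvd_exactPrimePart_of_sq_dvd {p : ℕ} [hp : Fact p.Prime] {d : ℤ}
    (hp2 : (p : ℤ) ^ 2 ∣ d) : ¬ (p : ℤ) ∣ exactPrimePart d := by
  rw [Int.natCast_dvd_natCast, exactPrimePart, hp.out.prime.dvd_finsetProd_iff]
  rintro ⟨q, hq, hpq⟩
  rw [Finset.mem_filter, Nat.mem_primeFactors] at hq
  obtain rfl := (Nat.prime_dvd_prime_iff_eq hp.out hq.1.1).mp hpq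
  rw [← Nat.cast_pow, Int.natCast_dvd] at hp2
  exact hq.2 hp2

theorem dvd_radical_of_sq_dvd {p : ℕ} [hp : Fact p.Prime] {d ds : ℤ} (hds0 : ds ≠ 0)
    (hds : d = ds * exactPrimePart d) (hp2 : (p : ℤ) ^ 2 ∣ d) :
    (p : ℤ) ∣ UniqueFactorizationMonoid.radical ds := by
  have hpZ : Prime (p : ℤ) := Nat.prime_iff_prime_int.mp hp.out
  have hpd : (p : ℤ) ∣ ds * exactPrimePart d := hds ▸ (dvd_pow_self _ two_ne_zero).trans hp2
  rw [UniqueFactorizationMonoid.dvd_radical_iff_of_irreducible hpZ.irreducible hds0]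
  exact (hpZ.dvd_or_dvd hpd).resolve_right (not_dvd_exactPrimePart_of_sq_dvd hp2)

theorem theorem3p3_general {K L E : Type*} [Field K] [NumberField K] [Field L] [NumberField L]
    [CommRing E] [Algebra ℚ E] (ιK : K →ₐ[ℚ] E) (ιL : L →ₐ[ℚ] E)
    (φ : K ≃ₗ[ℚ] L) (hφ : IsIntegralTraceIsometry φ)
    (c : E) (hc : c = traceCasimirPairing ℚ K ιK.toLinearMap (ιL.toLinearMap ∘ₗ φ.toLinearMap))
    (ds : ℤ) (hds : NumberField.discr K = ds * (exactPrimePart (NumberField.discr K) : ℤ)) :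
    IsIntegral ℤ ((ds : E) * c) ∧
    (NoWildRamification K →
      IsIntegral ℤ (((UniqueFactorizationMonoid.radical ds : ℤ) : E) * c)) ∧
    (Squarefree (NumberField.discr K) → IsIntegral ℤ c) := by
  subst hc
  have hφint (x : K) (hx : IsIntegral ℤ x) :
      IsIntegral ℤ ((ιL.toLinearMap ∘ₗ φ.toLinearMap) x) :=
    (hφ.isIntegral_iff.mpr hx).map (ιL.restrictScalars ℤ)
  refine ⟨hφ.isIntegral_intCast_mul_traceCasimirPairing ιK ιL ds fun p hp hp2 ↦ ?_,
    fun htame ↦ hφ.isIntegral_intCast_mul_traceCasimirPairing ιK ιL _ fun p hp hp2 ↦ ?_,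
    fun hsqf ↦ ?_⟩
  · have hpe := not_dvd_exactPrimePart_of_sq_dvd hp2
    refine mem_integralAt_of_smul_mem hpe (localIntegralClosure.mem_of_isIntegral ?_)
    rw [← zsmul_eq_mul, smul_smul, mul_comm, ← hds]
    exact isIntegral_zsmul_traceCasimirPairing ιK hφint
      (NumberField.discr_mem_differentIdeal K (𝓞 K))
  · have hds0 : ds ≠ 0 := left_ne_zero_of_mul (hds ▸ NumberField.discr_ne_zero K)
    obtain ⟨s, hs⟩ := dvd_radical_of_sq_dvd hds0 hds hp2
    obtain ⟨m, hm, hmp⟩ := exists_mul_mem_differentIdeal_of_tame (htame p · hp.out)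
    refine mem_integralAt_of_smul_mem hm (localIntegralClosure.mem_of_isIntegral ?_)
    rw [← zsmul_eq_mul, smul_smul, hs, ← mul_assoc, mul_comm _ s, mul_smul]
    exact (isIntegral_zsmul_traceCasimirPairing ιK hφint hmp).smul s
  · simpa using hφ.isIntegral_intCast_mul_traceCasimirPairing ιK ιL 1 fun p hp hp2 ↦
      absurd (hsqf p (sq (p : ℤ) ▸ hp2)) (Nat.prime_iff_prime_int.mp hp.out).not_isUnit

theorem theorem3p3 {K L E : Type*} [Field K] [NumberField K] [Field L] [NumberField L]
    [Field E] [NumberField E]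
    (ιK : K →ₐ[ℚ] E) (ιL : L →ₐ[ℚ] E) (hE : ιK.fieldRange ⊔ ιL.fieldRange = ⊤)
    (φ : K ≃ₗ[ℚ] L) (hφ : IsIntegralTraceIsometry φ)
    (c : E) (hc : c = traceCasimirPairing ℚ K ιK.toLinearMap (ιL.toLinearMap ∘ₗ φ.toLinearMap))
    (ds : ℤ) (hds : NumberField.discr K = ds * (exactPrimePart (NumberField.discr K) : ℤ)) :
    IsIntegral ℤ ((ds : E) * c) ∧
    (NoWildRamification K →
      IsIntegral ℤ (((UniqueFactorizationMonoid.radical ds : ℤ) : E) * c)) ∧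
    (Squarefree (NumberField.discr K) → IsIntegral ℤ c) := by
  exact theorem3p3_general ιK ιL φ hφ c hc ds hds
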